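/- All graphs are finite and simple. For positive integers $p,q$ with $p/q\ge 2$ let $G_{p,q}$ be the graph with vertex set $\{0,\dots,p-1\}$ in which $a,b$ are adjacent if and only if $q\le |a-b|\le p-q$. A graph $G$ is $(p,q)$-mixing if the graph $\mathrm{Col}(G,G_{p,q})$ is connected (in particular non-empty), where the vertices of $\mathrm{Col}(G,G_{p,q})$ are the homomorphisms $G\to G_{p,q}$, and two of them are adjacent if they differ on at most one vertex of $G$. If $x,y$ are vertices of $G$ at distance $2$, the elementary fold at $x,y$ is the quotient homomorphism $G\to G_{xy}$ onto the simple graph $G_{xy}$ obtained from $G$ by identifying $x$ and $y$. A graph $G$ folds to a graph $H$ if some composition of finitely many (possibly zero) elementary folds, starting at $G$, ends in a graph isomorphic to $H$. Let $p,q$ be positive integers with $2<\frac pq<4$. (i) If $G$ folds to $H$ and $H$ is not $(p,q)$-mixing, then $G$ is not $(p,q)$-mixing. (ii) If $p=2q+1$, then a connected bipartite graph $G$ is $(p,q)$-mixing if and only if $G$ does not fold to the cycle $C_{4q+2}$. -/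

import Mathlib

universe u v

namespace CircularMixing

/-- The circular clique `G_{p,q}`: vertices `0, …, p-1`, with `a` and `b` adjacent iff
`q ≤ |a - b| ≤ p - q`. The condition `a ≠ b` is implied when `q` is positive. -/
def circularClique (p q : ℕ) : SimpleGraph (Fin p) where
  Adj a b := a ≠ b ∧ (q : ℤ) ≤ |(a : ℤ) - (b : ℤ)| ∧ |(a : ℤ) - (b : ℤ)| ≤ (p : ℤ) - (q : ℤ)
  symm := ⟨fun a b h => ⟨h.1.symm, by rw [abs_sub_comm]; exact h.2⟩⟩
  loopless := ⟨fun _ h => h.1 rfl⟩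

/-- The reconfiguration graph `Col(G, K)`: its vertices are the homomorphisms `G → K`, two distinct
ones being adjacent iff they differ on at most one vertex. (The loops are omitted; they do not
matter for connectedness.) -/
def colGraph {V : Type u} {W : Type v} (G : SimpleGraph V) (K : SimpleGraph W) :
    SimpleGraph (G →g K) where
  Adj f g := f ≠ g ∧ {x : V | f x ≠ g x}.Subsingleton
  symm := ⟨fun f g h => ⟨h.1.symm, by simpa only [ne_comm] using h.2⟩⟩
  loopless := ⟨fun _ h => h.1 rfl⟩

/-- `G` is `K`-mixing: there is a homomorphism `G → K`, and any two of them are joined by a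
path in `Col(G, K)`. -/
def IsHomMixing {V : Type u} {W : Type v} (G : SimpleGraph V) (K : SimpleGraph W) : Prop :=
  (colGraph G K).Connected

/-- `G` is `(p,q)`-mixing. -/
def IsMixing {V : Type u} (p q : ℕ) (G : SimpleGraph V) : Prop :=
  IsHomMixing G (circularClique p q)

/-- The vertex set of `G_{xy}`: the quotient of `V` by the identification of `x` with `y`. -/
abbrev Identified {V : Type u} (x y : V) : Type u :=
  Quot (fun a b : V => a = x ∧ b = y)

/-- The graph `G_{xy}` obtained from `G` by identifying `x` and `y`: two distinct vertices of the
quotient are adjacent iff they have adjacent representatives. -/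
def identify {V : Type u} (G : SimpleGraph V) (x y : V) : SimpleGraph (Identified x y) :=
  G.map (Quot.mk _)

theorem mk_eq_mk {V : Type u} {x y a b : V}
    (h : (Quot.mk _ a : Identified x y) = Quot.mk _ b) :
    a = b ∨ (a = x ∧ b = y) ∨ (a = y ∧ b = x) := by
  have h' := Quot.eqvGen_exact h
  clear h
  induction h' with
  | rel a b h => exact Or.inr (Or.inl h)
  | refl a => exact Or.inl rfl
  | symm a b _ ih => grind
  | trans a b c _ _ ih1 ih2 => grind

/-- The elementary fold `G → G_{xy}` at two vertices `x`, `y` at distance `2`. -/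
def elementaryFold {V : Type u} (G : SimpleGraph V) (x y : V) (hxy : G.dist x y = 2) :
    G →g identify G x y where
  toFun := Quot.mk _
  map_rel' := by
    intro a b hab
    have hn : ¬ G.Adj x y := fun h => by
      rw [← SimpleGraph.dist_eq_one_iff_adj] at h
      omega
    refine ⟨fun h => ?_, a, b, hab, rfl, rfl⟩
    rcases mk_eq_mk h with h | ⟨rfl, rfl⟩ | ⟨rfl, rfl⟩
    · exact G.loopless.irrefl _ (h ▸ hab)
    · exact hn hab
    · exact hn hab.symm

/-- The foldings onto `H`: finite (possibly empty) compositions of elementary folds, followed by an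
isomorphism of the resulting graph with `H`. -/
inductive IsFolding {W : Type v} {H : SimpleGraph W} :
    {V : Type u} → {G : SimpleGraph V} → (G →g H) → Prop
  | iso {V : Type u} {G : SimpleGraph V} (e : G ≃g H) : IsFolding e.toHom
  | comp {V : Type u} {G : SimpleGraph V} (x y : V) (hxy : G.dist x y = 2)
      (f : identify G x y →g H) :
      IsFolding f → IsFolding (f.comp (elementaryFold G x y hxy))

/-- `G` folds to `H`. -/
def FoldsTo {V : Type u} {W : Type v} (G : SimpleGraph V) (H : SimpleGraph W) : Prop :=
  ∃ f : G →g H, IsFolding f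

end CircularMixing

/-!
Assign to each edge of `G_{p,q}` a signed displacement along the circle. As `p < 4 q`, displacements
around a 4-cycle cancel, so the wind of a colouring around a closed walk does not change when one
vertex is recoloured, and every closed walk of `G_{xy}` carries the wind of a closed walk of `G`.
Reflecting the colours negates the wind, so no colouring of a mixing graph has any. This forces the
graph to be bipartite, and conversely the colourings of a bipartite graph without wind lift to the
integers, where any two are joined through their pointwise minimum by lowering one vertex at a time.
Being windless passes along folds, which gives (i).

For `p = 2 q + 1`, a colouring with wind of a bipartite graph lifts to a map with wind to the cycle
of length `4 q + 2`. Folding together two neighbours of a vertex with the same image, one arrives at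
a locally injective map with wind, whose domain is a cycle covering the target. A proper covering is
replaced by a map that goes around once and then oscillates, so that the folding can continue.
-/

namespace CircularMixing

open Function SimpleGraph

section Exact

variable {V : Type u} {W : Type v} {A B : Type*} [AddCommGroup A] [AddCommGroup B]
  {G : SimpleGraph V} {H : SimpleGraph W}

/-- The 1-cochain `w` is exact on `G`: it is the difference of a potential on the vertices. Only the
values of `w` at edges matter. -/
def IsExact (G : SimpleGraph V) (w : V → V → A) : Prop :=
  ∃ F : V → A, ∀ u v, G.Adj u v → F v - F u = w u v

theorem isExact_sub (F : V → A) : IsExact G fun u v => F v - F u :=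
  ⟨F, fun _ _ _ => rfl⟩

namespace IsExact

theorem congr {w w' : V → V → A} (hw : IsExact G w) (h : ∀ u v, G.Adj u v → w u v = w' u v) :
    IsExact G w' := by
  obtain ⟨F, hF⟩ := hw
  exact ⟨F, fun u v huv => (hF u v huv).trans (h u v huv)⟩

theorem add {w w' : V → V → A} (hw : IsExact G w) (hw' : IsExact G w') :
    IsExact G (w + w') := by
  obtain ⟨F, hF⟩ := hw
  obtain ⟨F', hF'⟩ := hw'
  exact ⟨F + F', fun u v huv =>
    (add_sub_add_comm ..).trans (congrArg₂ (· + ·) (hF u v huv) (hF' u v huv))⟩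

theorem map (φ : A →+ B) {w : V → V → A} (hw : IsExact G w) :
    IsExact G fun u v => φ (w u v) := by
  obtain ⟨F, hF⟩ := hw
  exact ⟨fun v => φ (F v), fun u v huv => by rw [← map_sub, hF u v huv]⟩

theorem comp_hom {w : W → W → A} (hw : IsExact H w) (φ : G →g H) : IsExact G (w on φ) := by
  obtain ⟨F, hF⟩ := hw
  exact ⟨F ∘ φ, fun u v huv => hF _ _ (φ.map_adj huv)⟩

theorem of_mul {w : V → V → ℤ} {N : ℤ} (hN : N ≠ 0) (hw : IsExact G fun u v => N * w u v) :
    IsExact G w := by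
  obtain ⟨F, hF⟩ := hw
  refine ⟨fun v => F v / N, fun u v huv => ?_⟩
  have hFv : F v = F u + N * w u v := eq_add_of_sub_eq' (hF u v huv)
  simp only [hFv, Int.add_mul_ediv_left _ _ hN, add_sub_cancel_left]

theorem identify {x y : V} (hxy : (G.commonNeighbors x y).Nonempty)
    {w : Identified x y → Identified x y → A} (hw : IsExact G (w on Quot.mk _)) :
    IsExact (identify G x y) w := by
  obtain ⟨F, hF⟩ := hw
  obtain ⟨z, hxz, hyz⟩ := hxy
  have mk_eq : (Quot.mk _ x : Identified x y) = Quot.mk _ y := Quot.sound ⟨rfl, rfl⟩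
  have hFxy : F x = F y := by
    have hx := hF x z hxz
    have hy := hF y z hyz
    simp only [onFun, mk_eq] at hx hy
    exact sub_right_injective (hx.trans hy.symm)
  refine ⟨Quot.lift F (by rintro _ _ ⟨rfl, rfl⟩; exact hFxy), ?_⟩
  rintro _ _ ⟨-, a, b, hab, rfl, rfl⟩
  exact hF a b hab

end IsExact

theorem dist_eq_two_iff {x y : V} :
    G.dist x y = 2 ↔ x ≠ y ∧ ¬ G.Adj x y ∧ (G.commonNeighbors x y).Nonempty := by
  rw [← edist_eq_two_iff, SimpleGraph.dist, ENat.toNat_eq_iff two_ne_zero, Nat.cast_ofNat]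

theorem IsFolding.isExact {φ : G →g H} (hφ : IsFolding φ) {w : W → W → A}
    (hw : IsExact G (w on φ)) : IsExact H w := by
  induction hφ with
  | iso e => exact (hw.comp_hom e.symm.toHom).congr fun u v _ => by simp [onFun]
  | comp x y hxy f _ ih => exact ih (IsExact.identify (dist_eq_two_iff.1 hxy).2.2 hw)

theorem isBipartite_iff_isExact_one :
    G.IsBipartite ↔ IsExact G fun _ _ => (1 : ZMod 2) := by
  have sub_eq_one_iff : ∀ a b : ZMod 2, b - a = 1 ↔ a ≠ b := by decide
  constructor
  · rintro ⟨c⟩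
    exact ⟨c, fun u v huv => (sub_eq_one_iff _ _).2 (c.valid huv)⟩
  · rintro ⟨F, hF⟩
    exact ⟨Coloring.mk F fun huv => (sub_eq_one_iff _ _).1 (hF _ _ huv)⟩

theorem isExact_of_isTree (hG : G.IsTree) {w : V → V → A}
    (hw : ∀ u v, G.Adj u v → w v u = -w u v) : IsExact G w := by
  obtain ⟨r⟩ := hG.connected.nonempty
  choose path isPath _ using hG.existsUnique_path r
  let F (v : V) : A := ((path v).darts.map fun d => w d.fst d.snd).sum
  have sub_eq_of_mem : ∀ u v, G.Adj u v → u ∈ (path v).support → F v - F u = w u v := by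
    intro u v huv hu
    simp only [F, hG.isAcyclic.path_concat (isPath u) (isPath v) huv hu, Walk.darts_concat,
      List.concat_eq_append, List.map_append, List.sum_append, List.map_singleton,
      List.sum_singleton, add_sub_cancel_left]
  refine ⟨F, fun u v huv => ?_⟩
  by_cases hu : u ∈ (path v).support
  · exact sub_eq_of_mem u v huv hu
  · have hv := hG.isAcyclic.mem_support_of_ne_mem_support_of_adj_of_isPath
      (isPath u) (isPath v) huv hu
    rw [← neg_sub, sub_eq_of_mem v u huv.symm hv, hw u v huv, neg_neg]

end Exact

section CircularClique

variable {V : Type u} {G : SimpleGraph V} {p q : ℕ}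

/-- The displacement of the pair of colours `(a, b)`: if `d` is the length of the clockwise walk
from `a` to `b` on the circle of length `p`, it is `2 d - p`, so that it changes sign with the
direction of the edge. -/
def displacement (a b : Fin p) : ℤ :=
  2 * (((b : ℤ) - a) % p) - p

theorem displacement_eq (a b : Fin p) :
    displacement a b = 2 * ((b : ℤ) - a) - p * (2 * (((b : ℤ) - a) / p) + 1) := by
  rw [displacement, Int.emod_def]
  ring

theorem displacement_eq_of_lt {a b : Fin p} (h : a < b) :
    displacement a b = 2 * ((b : ℤ) - a) - p := by
  rw [displacement, Int.emod_eq_of_lt] <;> omega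

theorem displacement_eq_of_gt {a b : Fin p} (h : b < a) :
    displacement a b = 2 * ((b : ℤ) - a) + p := by
  rw [displacement, ← Int.add_emod_right, Int.emod_eq_of_lt] <;> omega

theorem displacement_swap {a b : Fin p} (h : a ≠ b) : displacement b a = -displacement a b := by
  rcases lt_or_gt_of_ne h with h | h <;>
    rw [displacement_eq_of_lt h, displacement_eq_of_gt h] <;> ring

theorem displacement_rev (a b : Fin p) : displacement a.rev b.rev = displacement b a := by
  rw [displacement, displacement, Fin.val_rev, Fin.val_rev]
  congr 3
  omega

theorem circularClique_adj_iff (hq : 0 < q) {a b : Fin p} :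
    (circularClique p q).Adj a b ↔ |displacement a b| ≤ p - 2 * q := by
  change (a ≠ b ∧ _ ∧ _) ↔ _
  rcases lt_trichotomy a b with h | rfl | h
  · simp only [displacement_eq_of_lt h, abs_le, le_abs]; omega
  · simp [displacement]; omega
  · rw [displacement_eq_of_gt h, abs_of_nonneg (by omega), abs_le]; omega

/-- The wind around the 4-cycle `a`, `d`, `b`, `c` is a multiple of `2 p` and smaller than `2 p`. -/
theorem displacement_sub_displacement (hq : 0 < q) (h4 : p < 4 * q) {a b c d : Fin p}
    (hac : (circularClique p q).Adj a c) (had : (circularClique p q).Adj a d)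
    (hbc : (circularClique p q).Adj b c) (hbd : (circularClique p q).Adj b d) :
    displacement a d - displacement a c = displacement b d - displacement b c := by
  have dvd_wind : (2 * p : ℤ) ∣ displacement a d - displacement a c -
      (displacement b d - displacement b c) :=
    ⟨(c - a : ℤ) / p - (d - a : ℤ) / p - ((c - b : ℤ) / p - (d - b : ℤ) / p), by
      simp only [displacement_eq]; ring⟩
  rw [circularClique_adj_iff hq, abs_le] at hac had hbc hbd
  exact sub_eq_zero.1 (Int.eq_zero_of_abs_lt_dvd dvd_wind (abs_lt.2 (by omega)))

theorem isExact_displacement_sub (hq : 0 < q) (h4 : p < 4 * q) {f g : G →g circularClique p q}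
    {x : V} (hfg : ∀ v, v ≠ x → f v = g v) :
    IsExact G fun u v => displacement (g u) (g v) - displacement (f u) (f v) := by
  classical
  obtain ⟨δ, hδ⟩ : ∃ δ : ℤ, ∀ u, G.Adj u x →
      displacement (f u) (g x) - displacement (f u) (f x) = δ := by
    have adj_g : ∀ u, G.Adj u x → (circularClique p q).Adj (f u) (g x) := fun u hu => by
      rw [hfg u hu.ne]; exact g.map_adj hu
    by_cases h : ∃ u, G.Adj u x
    · obtain ⟨t, ht⟩ := h
      exact ⟨_, fun u hu => displacement_sub_displacement hq h4
        (f.map_adj hu) (adj_g u hu) (f.map_adj ht) (adj_g t ht)⟩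
    · exact ⟨0, fun u hu => (h ⟨u, hu⟩).elim⟩
  refine ⟨Pi.single x δ, fun u v huv => ?_⟩
  dsimp only
  rcases eq_or_ne v x with rfl | hv
  · rw [Pi.single_eq_same, Pi.single_eq_of_ne huv.ne, ← hfg u huv.ne, hδ u huv, sub_zero]
  rcases eq_or_ne u x with rfl | hu
  · rw [Pi.single_eq_same, Pi.single_eq_of_ne hv, ← hδ v huv.symm,
      displacement_swap (g.map_adj huv.symm).ne, displacement_swap (f.map_adj huv.symm).ne,
      hfg v hv]
    ring
  · rw [Pi.single_eq_of_ne hu, Pi.single_eq_of_ne hv, hfg u hu, hfg v hv, sub_self, sub_self]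

theorem exists_eq_of_colGraph_adj {W : Type v} {K : SimpleGraph W} {f g : G →g K}
    (h : (colGraph G K).Adj f g) : ∃ x, ∀ v, v ≠ x → f v = g v := by
  obtain ⟨x, hx⟩ := DFunLike.exists_ne h.1
  exact ⟨x, fun v hv => by_contra fun hfg => hv (h.2 hfg hx)⟩

theorem isExact_displacement_sub_of_reachable (hq : 0 < q) (h4 : p < 4 * q)
    {f g : G →g circularClique p q} (h : (colGraph G (circularClique p q)).Reachable f g) :
    IsExact G fun u v => displacement (g u) (g v) - displacement (f u) (f v) := by
  obtain ⟨w⟩ := h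
  induction w with
  | nil => exact ⟨0, by simp⟩
  | cons hadj _ ih =>
    obtain ⟨x, hx⟩ := exists_eq_of_colGraph_adj hadj
    exact (ih.add (isExact_displacement_sub hq h4 hx)).congr fun u v _ => sub_add_sub_cancel ..

/-- The reflection of a circular clique, which reverses displacements. -/
def reflection (p q : ℕ) : circularClique p q →g circularClique p q where
  toFun := Fin.rev
  map_rel' := by
    rintro a b ⟨hne, hab⟩
    refine ⟨Fin.rev_injective.ne hne, ?_⟩
    have sub_rev : ((a.rev : ℕ) : ℤ) - (b.rev : ℕ) = b - a := by
      rw [Fin.val_rev, Fin.val_rev]; omega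
    rwa [sub_rev, abs_sub_comm]

theorem IsMixing.isExact_displacement (hq : 0 < q) (h4 : p < 4 * q) (hG : IsMixing p q G)
    (f : G →g circularClique p q) : IsExact G (displacement on f) := by
  have h := isExact_displacement_sub_of_reachable hq h4
    (hG.preconnected ((reflection p q).comp f) f)
  refine IsExact.of_mul two_ne_zero (h.congr fun u v huv => ?_)
  have hrev : displacement ((reflection p q).comp f u) ((reflection p q).comp f v) =
      displacement (f v) (f u) := displacement_rev (f u) (f v)
  rw [hrev, displacement_swap (f.map_adj huv).ne, onFun]
  ring

/-- Modulo the coboundary of `2 f`, displacements are odd multiples of `p`. -/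
theorem isBipartite_of_isExact_displacement [NeZero p] {f : V → Fin p}
    (hf : IsExact G (displacement on f)) : G.IsBipartite := by
  have hodd : IsExact G fun u v => 2 * (((f v : ℤ) - f u) / p) + 1 := by
    refine IsExact.of_mul (N := -p) (by simpa using NeZero.ne p)
      ((hf.add (isExact_sub fun v => -2 * (f v : ℤ))).congr fun u v _ => ?_)
    simp only [Pi.add_apply, onFun, displacement_eq]
    ring
  refine isBipartite_iff_isExact_one.2 ((hodd.map (Int.castAddHom (ZMod 2))).congr fun u v _ => ?_)
  have two_eq_zero : (2 : ZMod 2) = 0 := rfl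
  simp [two_eq_zero]

/-- `G` is bipartite and no `(p,q)`-colouring of `G` has nonzero wind around a closed walk. -/
def IsWindless (p q : ℕ) (G : SimpleGraph V) : Prop :=
  G.IsBipartite ∧ ∀ f : G →g circularClique p q, IsExact G (displacement on f)

theorem IsMixing.isWindless [NeZero p] (hq : 0 < q) (h4 : p < 4 * q)
    (hG : IsMixing p q G) : IsWindless p q G := by
  obtain ⟨f⟩ := hG.nonempty
  exact ⟨isBipartite_of_isExact_displacement (hG.isExact_displacement hq h4 f),
    hG.isExact_displacement hq h4⟩

end CircularClique

section Lift

variable {V : Type u} {W : Type v} {G : SimpleGraph V} {K : SimpleGraph W} {p q : ℕ}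
  {c L M : V → ℤ}

theorem exists_odd_sub_of_isBipartite (hG : G.IsBipartite) :
    ∃ c : V → ℤ, ∀ u v, G.Adj u v → Odd (c v - c u) := by
  obtain ⟨F, hF⟩ := isBipartite_iff_isExact_one.1 hG
  refine ⟨fun v => (F v).val, fun u v huv => ZMod.intCast_eq_one_iff_odd.1 ?_⟩
  simpa using hF u v huv

theorem reachable_colGraph {f g : G →g K} {x : V} (h : ∀ v, v ≠ x → f v = g v) :
    (colGraph G K).Reachable f g := by
  by_cases hfg : f = g
  · rw [hfg]
  · refine Adj.reachable ⟨hfg, Set.subsingleton_of_subset_singleton (a := x) fun v hv => ?_⟩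
    exact by_contra fun hvx => hv (h v hvx)

/-- The residue class of `n` modulo `p`, as a vertex of the circular clique. -/
def residue (p : ℕ) [NeZero p] (n : ℤ) : Fin p :=
  ⟨(n : ZMod p).val, ZMod.val_lt _⟩

theorem val_residue [NeZero p] (n : ℤ) : ((residue p n : ℕ) : ℤ) = n % p :=
  ZMod.val_intCast n

theorem residue_val_add_mul [NeZero p] (a : Fin p) (k : ℤ) : residue p (a + p * k) = a := by
  apply Fin.ext
  zify
  rw [val_residue, Int.add_mul_emod_self_left, Int.emod_eq_of_lt] <;> omega

theorem displacement_residue [NeZero p] (m n : ℤ) :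
    displacement (residue p m) (residue p n) = 2 * ((n - m) % p) - p := by
  rw [displacement, val_residue, val_residue, ← Int.sub_emod]

theorem adj_residue [NeZero p] (hq : 0 < q) {m n e : ℤ} (he : Odd e)
    (h : |2 * (n - m) - p * e| ≤ p - 2 * q) :
    (circularClique p q).Adj (residue p m) (residue p n) := by
  obtain ⟨k, rfl⟩ := he
  have hmod : (n - m) % p = n - m - p * k := by
    rw [← Int.sub_mul_emod_self_left _ _ k]
    rw [mul_add, abs_le] at h
    apply Int.emod_eq_of_lt <;> grind
  rw [circularClique_adj_iff hq, displacement_residue, hmod]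
  convert h using 2
  ring

/-- `L` lifts a `(p,q)`-colouring to the integers, where `c` takes values of opposite parity at
adjacent vertices: `2 L - p c` is a potential for the displacements of the colouring, and these are
bounded by `p - 2 q`. -/
def IsLift (G : SimpleGraph V) (p q : ℕ) (c L : V → ℤ) : Prop :=
  ∀ u v, G.Adj u v → |2 * (L v - L u) - p * (c v - c u)| ≤ p - 2 * q

namespace IsLift

/-- The colouring lifted by `L`. -/
def toHom [NeZero p] (hq : 0 < q) (hc : ∀ u v, G.Adj u v → Odd (c v - c u))
    (hL : IsLift G p q c L) : G →g circularClique p q where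
  toFun v := residue p (L v)
  map_rel' huv := adj_residue hq (hc _ _ huv) (hL _ _ huv)

theorem inf (hL : IsLift G p q c L) (hM : IsLift G p q c M) : IsLift G p q c (L ⊓ M) := by
  intro u v huv
  have hLuv := hL u v huv
  have hMuv := hM u v huv
  simp only [abs_le, Pi.inf_apply] at hLuv hMuv ⊢
  omega

theorem update_sub_one [DecidableEq V] (hL : IsLift G p q c L) {x : V}
    (hx : ∀ v, G.Adj x v → 2 * (L v - L x) - p * (c v - c x) + 2 ≤ p - 2 * q) :
    IsLift G p q c (update L x (L x - 1)) := by
  have lowered : ∀ v, G.Adj x v →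
      |2 * (L v - (L x - 1)) - p * (c v - c x)| ≤ p - 2 * q := fun v hv => by
    have hLv := hL x v hv
    have hxv := hx v hv
    rw [abs_le] at hLv ⊢
    omega
  intro u v huv
  rcases eq_or_ne u x with rfl | hu
  · rw [update_self, update_of_ne huv.ne']
    exact lowered v huv
  rcases eq_or_ne v x with rfl | hv
  · rw [update_self, update_of_ne hu, ← abs_neg]
    convert lowered u huv.symm using 2
    ring
  · rw [update_of_ne hu, update_of_ne hv]
    exact hL u v huv

/-- Among the vertices where `L` exceeds `M`, one that maximises the potential `2 L - p c` can be
lowered. -/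
theorem exists_isLift_update [Finite V] [DecidableEq V] (h2 : 2 * q < p)
    (hc : ∀ u v, G.Adj u v → Odd (c v - c u)) (hL : IsLift G p q c L) (hM : IsLift G p q c M)
    (hlt : ∃ v, M v < L v) : ∃ x, M x < L x ∧ IsLift G p q c (update L x (L x - 1)) := by
  obtain ⟨x, (hx : M x < L x), hmax⟩ :=
    Set.exists_max_image {v | M v < L v} (fun v => 2 * L v - p * c v) (Set.toFinite _) hlt
  refine ⟨x, hx, hL.update_sub_one fun v hv => ?_⟩
  rcases lt_or_ge (M v) (L v) with hMv | hMv
  · have hle := hmax v hMv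
    obtain ⟨k, hk⟩ := hc x v hv
    have hck : p * (c v - c x) = 2 * (p * k) + p := by rw [hk]; ring
    rw [mul_sub] at hck
    rw [mul_sub (p : ℤ)]
    omega
  · have hMxv := hM x v hv
    rw [abs_le] at hMxv
    omega

theorem reachable_of_le [Finite V] [NeZero p] (hq : 0 < q) (h2 : 2 * q < p)
    (hc : ∀ u v, G.Adj u v → Odd (c v - c u)) (hL : IsLift G p q c L) (hM : IsLift G p q c M)
    (hML : M ≤ L) :
    (colGraph G (circularClique p q)).Reachable (hL.toHom hq hc) (hM.toHom hq hc) := by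
  classical
  have := Fintype.ofFinite V
  induction hn : ∑ v, (L v - M v).toNat using Nat.strong_induction_on generalizing L with
  | _ n ih =>
    by_cases hlt : ∃ v, M v < L v
    · obtain ⟨x, hx, hL'⟩ := hL.exists_isLift_update h2 hc hM hlt
      have hle : M ≤ update L x (L x - 1) := le_update_iff.2 ⟨by omega, fun v _ => hML v⟩
      have hle' : update L x (L x - 1) ≤ L := update_le_self_iff.2 (sub_one_lt _).le
      have hsum : ∑ v, (update L x (L x - 1) v - M v).toNat < n := by
        refine hn ▸ Finset.sum_lt_sum (fun v _ => ?_) ⟨x, Finset.mem_univ x, ?_⟩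
        · exact Int.toNat_le_toNat (sub_le_sub_right (hle' v) _)
        · rw [update_self]
          omega
      refine .trans (reachable_colGraph (x := x) fun v hv => ?_) (ih _ hsum hL' hle rfl)
      exact congrArg (residue p) (update_of_ne hv _ _).symm
    · push Not at hlt
      obtain rfl : L = M := le_antisymm hlt hML
      rfl

theorem reachable [Finite V] [NeZero p] (hq : 0 < q) (h2 : 2 * q < p)
    (hc : ∀ u v, G.Adj u v → Odd (c v - c u)) (hL : IsLift G p q c L) (hM : IsLift G p q c M) :
    (colGraph G (circularClique p q)).Reachable (hL.toHom hq hc) (hM.toHom hq hc) :=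
  (hL.reachable_of_le hq h2 hc (hL.inf hM) inf_le_left).trans
    (hM.reachable_of_le hq h2 hc (hL.inf hM) inf_le_right).symm

end IsLift

theorem exists_isLift (h2 : 2 * q < p) (hc : ∀ u v, G.Adj u v → Odd (c v - c u)) :
    ∃ L, IsLift G p q c L := by
  refine ⟨fun v => p * c v / 2, fun u v huv => ?_⟩
  dsimp only
  obtain ⟨k, hk⟩ := hc u v huv
  have hck : p * (c v - c u) = 2 * (p * k) + p := by rw [hk]; ring
  rw [mul_sub] at hck
  rw [mul_sub (p : ℤ), abs_le]
  omega

theorem exists_isLift_of_isExact [NeZero p] (hq : 0 < q)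
    (hc : ∀ u v, G.Adj u v → Odd (c v - c u)) {f : G →g circularClique p q}
    (hf : IsExact G (displacement on f)) :
    ∃ L, ∃ hL : IsLift G p q c L, f = hL.toHom hq hc := by
  obtain ⟨k, hk⟩ : IsExact G fun u v => (c v - c u - 1) / 2 - ((f v : ℤ) - f u) / p := by
    refine IsExact.of_mul (N := 2 * p) (by simpa using NeZero.ne p)
      ((hf.add (isExact_sub fun v => p * c v - 2 * (f v : ℤ))).congr fun u v huv => ?_)
    obtain ⟨m, hm⟩ := hc u v huv
    rw [hm, add_sub_cancel_right, Int.mul_ediv_cancel_left _ two_ne_zero]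
    simp only [Pi.add_apply, onFun, displacement_eq]
    linear_combination (p : ℤ) * hm
  refine ⟨fun v => f v + p * k v, fun u v huv => ?_, DFunLike.ext _ _ fun v =>
    (residue_val_add_mul (f v) (k v)).symm⟩
  convert (circularClique_adj_iff hq).1 (f.map_adj huv) using 2
  obtain ⟨m, hm⟩ := hc u v huv
  have hkm := hk u v huv
  simp only [hm, add_sub_cancel_right, Int.mul_ediv_cancel_left _ two_ne_zero] at hkm
  rw [displacement_eq]
  linear_combination 2 * p * hkm - p * hm

theorem IsWindless.isMixing [Finite V] [NeZero p] (hq : 0 < q) (h2 : 2 * q < p)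
    (hG : IsWindless p q G) : IsMixing p q G := by
  obtain ⟨c, hc⟩ := exists_odd_sub_of_isBipartite hG.1
  obtain ⟨L, hL⟩ := exists_isLift h2 hc
  have : Nonempty (G →g circularClique p q) := ⟨hL.toHom hq hc⟩
  refine Connected.mk fun f g => ?_
  obtain ⟨L, hL, rfl⟩ := exists_isLift_of_isExact hq hc (hG.2 f)
  obtain ⟨M, hM, rfl⟩ := exists_isLift_of_isExact hq hc (hG.2 g)
  exact hL.reachable hq h2 hc hM

theorem isMixing_iff_isWindless [Finite V] (hq : 0 < q) (h2 : 2 * q < p) (h4 : p < 4 * q) :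
    IsMixing p q G ↔ IsWindless p q G := by
  have : NeZero p := ⟨by omega⟩
  exact ⟨fun h => h.isWindless hq h4, fun h => h.isMixing hq h2⟩

end Lift

section Cycle

variable {V : Type u} {W : Type v} {A : Type*} [AddCommGroup A] {G : SimpleGraph V}
  {K : SimpleGraph W} {m n : ℕ}

/-- The cycle of length `n` on the vertex set `ZMod n`. -/
abbrev zmodCycle (n : ℕ) : SimpleGraph (ZMod n) :=
  circulantGraph {1}

theorem nonempty_zmodCycle_iso_cycleGraph [NeZero n] : Nonempty (zmodCycle n ≃g cycleGraph n) := by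
  obtain ⟨k, rfl⟩ := Nat.exists_eq_succ_of_ne_zero (NeZero.ne n)
  rw [Nat.succ_eq_add_one, cycleGraph_eq_circulantGraph]
  exact ⟨Iso.refl⟩

theorem zmodCycle_adj_iff [Fact (2 < n)] {a b : ZMod n} :
    (zmodCycle n).Adj a b ↔ b - a = 1 ∨ b - a = -1 := by
  have zero_ne_one : (0 : ZMod n) ≠ 1 := fun h => ZMod.neg_one_ne_one (n := n) (by simp [← h])
  rw [circulantGraph_adj, Set.mem_singleton_iff, Set.mem_singleton_iff, ← neg_sub b a,
    neg_eq_iff_eq_neg, or_comm, and_iff_right_iff_imp]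
  rintro h rfl
  rw [sub_self, zero_eq_neg, or_iff_left_of_imp Eq.symm] at h
  exact zero_ne_one h

theorem IsExact.sum_range_eq_zero {w : V → V → A} (hw : IsExact G w) {φ : ℕ → V}
    (hadj : ∀ i < m, G.Adj (φ i) (φ (i + 1))) (hφ : φ m = φ 0) :
    ∑ i ∈ Finset.range m, w (φ i) (φ (i + 1)) = 0 := by
  obtain ⟨F, hF⟩ := hw
  rw [← Finset.sum_congr rfl fun i hi => hF _ _ (hadj i (Finset.mem_range.1 hi)),
    Finset.sum_range_sub fun i => F (φ i), hφ, sub_self]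

section ClosedWalk

variable [NeZero m] {φ : ℕ → W}

theorem apply_val_natCast (hφ : φ m = φ 0) {i : ℕ} (hi : i ≤ m) :
    φ (i : ZMod m).val = φ i := by
  rcases hi.lt_or_eq with hi | rfl
  · rw [ZMod.val_natCast_of_lt hi]
  · rw [ZMod.natCast_self, ZMod.val_zero, hφ]

/-- The closed walk `φ 0, …, φ m` in `K`, as a homomorphism from a cycle. -/
def closedWalkHom (hadj : ∀ i < m, K.Adj (φ i) (φ (i + 1))) (hφ : φ m = φ 0) :
    zmodCycle m →g K where
  toFun a := φ a.val
  map_rel' := by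
    have adj_succ : ∀ a : ZMod m, K.Adj (φ a.val) (φ (a + 1).val) := fun a => by
      have ha := hadj a.val a.val_lt
      rwa [← apply_val_natCast hφ (Nat.succ_le_of_lt a.val_lt), Nat.cast_succ,
        ZMod.natCast_zmod_val] at ha
    rintro a b ⟨-, h | h⟩
    · rw [← sub_add_cancel a b, Set.mem_singleton_iff.1 h, add_comm]
      exact (adj_succ b).symm
    · rw [← sub_add_cancel b a, Set.mem_singleton_iff.1 h, add_comm]
      exact adj_succ a

theorem closedWalkHom_natCast (hadj : ∀ i < m, K.Adj (φ i) (φ (i + 1))) (hφ : φ m = φ 0) {i : ℕ}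
    (hi : i ≤ m) : closedWalkHom hadj hφ i = φ i :=
  apply_val_natCast hφ hi

theorem not_isExact_closedWalkHom (hadj : ∀ i < m, K.Adj (φ i) (φ (i + 1))) (hφ : φ m = φ 0)
    {w : W → W → A} (hw : ∑ i ∈ Finset.range m, w (φ i) (φ (i + 1)) ≠ 0) :
    ¬ IsExact (zmodCycle m) (w on closedWalkHom hadj hφ) := by
  intro hexact
  have hcast {i : ℕ} (hi : i ≤ m) := closedWalkHom_natCast hadj hφ hi
  have adj_natCast : ∀ i < m, (zmodCycle m).Adj (i : ZMod m) ((i + 1 : ℕ) : ZMod m) := by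
    intro i hi
    rw [circulantGraph_adj]
    refine ⟨ne_of_apply_ne (closedWalkHom hadj hφ) ?_, Or.inr ?_⟩
    · rw [hcast hi.le, hcast hi]
      exact (hadj i hi).ne
    · simp
  refine hw ((Finset.sum_congr rfl fun i hi => ?_).trans
    (hexact.sum_range_eq_zero (φ := Nat.cast) adj_natCast (by simp)))
  rw [onFun, hcast (Finset.mem_range.1 hi).le, hcast (Finset.mem_range.1 hi)]

end ClosedWalk

/-- The signed length of an edge of `zmodCycle n`. Along a homomorphism `g` to the cycle, this
cochain is exact if and only if `g` winds around the cycle along no closed walk. -/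
def cyclicStep (a b : ZMod n) : ℤ :=
  if b - a = 1 then 1 else -1

theorem cyclicStep_eq [Fact (2 < n)] {a b : ZMod n} {d : ℤ} (hd : d = 1 ∨ d = -1)
    (hab : b - a = d) : cyclicStep a b = d := by
  rcases hd with rfl | rfl <;> simp [cyclicStep, hab, ZMod.neg_one_ne_one]

theorem cyclicStep_swap [Fact (2 < n)] {a b : ZMod n} (h : (zmodCycle n).Adj a b) :
    cyclicStep b a = -cyclicStep a b := by
  rcases zmodCycle_adj_iff.1 h with h | h
  · rw [cyclicStep_eq (a := b) (d := -1) (.inr rfl) (by simp [← neg_sub b a, h]),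
      cyclicStep_eq (d := 1) (.inl rfl) (by simpa using h)]
  · rw [cyclicStep_eq (a := b) (d := 1) (.inl rfl) (by simp [← neg_sub b a, h]),
      cyclicStep_eq (d := -1) (.inr rfl) (by simpa using h), neg_neg]

theorem isExact_cyclicStep_of_not_exists_succ [Finite V] [Fact (2 < n)] (hG : G.Connected)
    {g : G →g zmodCycle n} (hg : ∀ u, (G.neighborSet u).InjOn g) {r : V}
    (hr : ∀ v, G.Adj r v → g v - g r ≠ 1) : IsExact G (cyclicStep on g) := by
  have exists_succ : ∀ u, ∃ v, ∀ w, G.Adj u w → g w - g u = 1 → w = v := fun u => by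
    by_cases h : ∃ v, G.Adj u v ∧ g v - g u = 1
    · obtain ⟨v, huv, hv⟩ := h
      exact ⟨v, fun w huw hw => hg u huw huv (sub_left_injective (hw.trans hv.symm))⟩
    · exact ⟨u, fun w huw hw => (h ⟨w, huw, hw⟩).elim⟩
  choose succ eq_succ using exists_succ
  have edgeSet_subset : G.edgeSet ⊆ (fun u => s(u, succ u)) '' {r}ᶜ := by
    have mem_image {u v : V} (huv : G.Adj u v) (h : g v - g u = 1) :
        s(u, v) ∈ (fun u => s(u, succ u)) '' {r}ᶜ :=
      ⟨u, by rintro rfl; exact hr v huv h, by rw [eq_succ u v huv h]⟩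
    intro e he
    induction e with
    | _ u v =>
      rcases zmodCycle_adj_iff.1 (g.map_adj he) with h | h
      · exact mem_image he h
      · rw [Sym2.eq_swap]
        exact mem_image (G.adj_symm he) (by rw [← neg_sub, h, neg_neg])
  have card_edgeSet_lt : Nat.card G.edgeSet < Nat.card V := calc
    Nat.card G.edgeSet ≤ ({r}ᶜ : Set V).ncard :=
      (Set.ncard_le_ncard edgeSet_subset).trans (Set.ncard_image_le (Set.toFinite _))
    _ < Nat.card V := Set.ncard_lt_card (by simp)
  have hle := hG.card_vert_le_card_edgeSet_add_one
  exact isExact_of_isTree (isTree_iff_connected_and_card.2 ⟨hG, by omega⟩)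
    fun u v huv => cyclicStep_swap (g.map_adj huv)

theorem exists_zmodCycle_iso (hG : G.Connected) {σ : Equiv.Perm V}
    (hσ : ∀ u v, G.Adj u v ↔ v = σ u ∨ u = σ v) :
    ∃ m, ∃ e : zmodCycle m ≃g G, ∀ a, e (a + 1) = σ (e a) := by
  obtain ⟨r⟩ := hG.nonempty
  have sameCycle : ∀ v, σ.SameCycle r v := fun v => by
    induction (reachable_iff_reflTransGen r v).1 (hG.preconnected r v) with
    | refl => exact .refl σ r
    | tail _ huv ih =>
      rcases (hσ _ _).1 huv with rfl | rfl
      · exact ih.apply_right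
      · exact Equiv.Perm.sameCycle_apply_right.1 ih
  let e (k : ZMod (minimalPeriod (σ • ·) r)) : V := (MulAction.orbitZPowersEquiv σ r).symm k
  have e_intCast : ∀ k : ℤ, e k = (σ ^ k) r := fun k => by
    simp only [e, MulAction.orbitZPowersEquiv_symm_apply']
    rfl
  have e_succ : ∀ k, e (k + 1) = σ (e k) := fun k => by
    obtain ⟨k, rfl⟩ := ZMod.intCast_surjective k
    rw [← Int.cast_one, ← Int.cast_add, e_intCast, e_intCast, add_comm, zpow_one_add]
    rfl
  have e_bijective : Bijective e := by
    refine ⟨Subtype.val_injective.comp (Equiv.injective _), fun v => ?_⟩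
    obtain ⟨k, hk⟩ := sameCycle v
    exact ⟨k, (e_intCast k).trans hk⟩
  refine ⟨_, ⟨Equiv.ofBijective e e_bijective, fun {a b} => ?_⟩, e_succ⟩
  have sub_eq_one_iff : ∀ a b, b - a = 1 ↔ e b = σ (e a) := fun a b => by
    rw [sub_eq_iff_eq_add', ← e_succ, e_bijective.injective.eq_iff]
  rw [circulantGraph_adj, Set.mem_singleton_iff, Set.mem_singleton_iff, sub_eq_one_iff,
    sub_eq_one_iff, or_comm, ← hσ]
  exact (and_iff_right_of_imp fun h => ne_of_apply_ne e h.ne).symm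

end Cycle

section Fold

variable {V : Type u} {W : Type v} {G : SimpleGraph V} {K : SimpleGraph W} {m n p q : ℕ}

theorem exists_zmodCycle_mul_iso [Finite V] [Fact (2 < n)] (hG : G.Connected) {g : G →g zmodCycle n}
    (hg : ∀ u, (G.neighborSet u).InjOn g) (hsucc : ∀ u, ∃ v, G.Adj u v ∧ g v - g u = 1) :
    ∃ k ≠ 0, Nonempty (zmodCycle (n * k) ≃g G) := by
  choose succ adj_succ map_succ using hsucc
  have eq_succ : ∀ u v, G.Adj u v → g v - g u = 1 → v = succ u := fun u v huv h =>
    hg u huv (adj_succ u) (sub_left_injective (h.trans (map_succ u).symm))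
  have succ_injective : Injective succ := fun u v huv => by
    refine hg (succ u) (adj_succ u).symm (huv ▸ (adj_succ v).symm) ?_
    exact sub_right_injective ((map_succ u).trans (huv ▸ map_succ v).symm)
  let σ := Equiv.ofBijective succ (Finite.injective_iff_bijective.1 succ_injective)
  have adj_iff : ∀ u v, G.Adj u v ↔ v = σ u ∨ u = σ v := fun u v => by
    refine ⟨fun huv => ?_, ?_⟩
    · rcases zmodCycle_adj_iff.1 (g.map_adj huv) with h | h
      · exact .inl (eq_succ u v huv h)
      · exact .inr (eq_succ v u huv.symm (by rw [← neg_sub, h, neg_neg]))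
    · rintro (rfl | rfl)
      · exact adj_succ u
      · exact (adj_succ v).symm
  obtain ⟨m, e, he⟩ := exists_zmodCycle_iso hG adj_iff
  have map_natCast : ∀ k : ℕ, g (e k) = g (e 0) + k := fun k => by
    induction k with
    | zero => simp
    | succ k ih =>
      rw [Nat.cast_succ, Nat.cast_succ, he, ← add_assoc, ← ih]
      exact eq_add_of_sub_eq' (map_succ _)
  obtain ⟨k, rfl⟩ : n ∣ m := by
    rw [← ZMod.natCast_eq_zero_iff]
    simpa using map_natCast m
  have : Finite (ZMod (n * k)) := .of_equiv V e.symm.toEquiv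
  refine ⟨k, ?_, ⟨e⟩⟩
  rintro rfl
  rw [mul_zero] at this
  exact not_finite (ZMod 0)

/-- The walk climbs from `0` to `n` and then oscillates between `n` and `n + 1`. -/
theorem exists_zmodCycle_hom_not_injOn [Fact (2 < n)] (hnm : n < m) (hm : Even (m - n)) :
    ∃ h : zmodCycle m →g zmodCycle n, ¬ IsExact (zmodCycle m) (cyclicStep on h) ∧
      ¬ ∀ u, ((zmodCycle m).neighborSet u).InjOn h := by
  have hn : 2 < n := Fact.out
  have : Fact (2 < m) := ⟨hn.trans hnm⟩
  have : NeZero m := ⟨by omega⟩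
  have hm' := Nat.even_iff.1 hm
  let height (i : ℕ) : ℤ := (min i n + (i - n) % 2 : ℕ)
  have height_step : ∀ i, height (i + 1) - height i = 1 ∨ height (i + 1) - height i = -1 := by
    intro i
    simp only [height]
    omega
  have height_zero : height 0 = 0 := by simp [height]
  have height_last : height m = n := by simp only [height]; omega
  have adj_height : ∀ i < m, (zmodCycle n).Adj (height i) (height (i + 1)) := fun i _ => by
    rw [zmodCycle_adj_iff]
    exact_mod_cast (height_step i).imp (congrArg (Int.cast (R := ZMod n)))
      (congrArg (Int.cast (R := ZMod n)))
  have height_closed : (height m : ZMod n) = height 0 := by simp [height_last, height_zero]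
  refine ⟨closedWalkHom (φ := fun i => (height i : ZMod n)) adj_height height_closed,
    not_isExact_closedWalkHom _ _ ?_, fun hinj => ?_⟩
  · rw [Finset.sum_congr rfl fun i _ => cyclicStep_eq (height_step i) (Int.cast_sub _ _).symm,
      Finset.sum_range_sub, height_last, height_zero]
    omega
  · have hcast {i : ℕ} (hi : i ≤ m) := closedWalkHom_natCast adj_height height_closed hi
    have h := hinj ((n + 1 : ℕ) : ZMod m) (x₁ := (n : ℕ)) (x₂ := (n + 2 : ℕ))
      (zmodCycle_adj_iff.2 (.inr (by push_cast; ring)))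
      (zmodCycle_adj_iff.2 (.inl (by push_cast; ring)))
      (by rw [hcast (by omega), hcast (by omega)]; simp [height])
    rw [ZMod.natCast_eq_natCast_iff, Nat.modEq_iff_dvd' (by omega), Nat.add_sub_cancel_left] at h
    exact (Nat.le_of_dvd two_pos h).not_gt Fact.out

theorem nonempty_zmodCycle_iso_of_forall_injOn [Finite V] [Fact (2 < n)] (hn : Even n)
    (hG : G.Connected) {g : G →g zmodCycle n} (hg : ¬ IsExact G (cyclicStep on g))
    (hinj : ∀ g : G →g zmodCycle n, ¬ IsExact G (cyclicStep on g) →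
      ∀ u, (G.neighborSet u).InjOn g) : Nonempty (zmodCycle n ≃g G) := by
  have exists_succ : ∀ u, ∃ v, G.Adj u v ∧ g v - g u = 1 := by
    by_contra! h
    obtain ⟨r, hr⟩ := h
    exact hg (isExact_cyclicStep_of_not_exists_succ hG (hinj g hg) hr)
  obtain ⟨k, hk, ⟨e⟩⟩ := exists_zmodCycle_mul_iso hG (hinj g hg) exists_succ
  obtain rfl | hk : k = 1 ∨ 1 < k := by omega
  · rw [mul_one] at e
    exact ⟨e⟩
  have hn2 : 2 < n := Fact.out
  obtain ⟨h, hh, hh'⟩ := exists_zmodCycle_hom_not_injOn (n := n) (m := n * k) (by nlinarith)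
    ((hn.mul_right k).tsub hn)
  refine (hh' fun u a ha b hb hab => e.injective ?_).elim
  refine hinj (h.comp e.symm.toHom) (fun hexact => hh ?_) (e u) (e.map_adj_iff.2 ha)
    (e.map_adj_iff.2 hb) (by simpa using hab)
  exact (hexact.comp_hom e.toHom).congr fun a b _ => by simp [onFun]

/-- The homomorphism induced on `G_{xy}` by a homomorphism identifying `x` and `y`. -/
def identifyLift (φ : G →g K) {x y : V} (h : φ x = φ y) : identify G x y →g K where
  toFun := Quot.lift φ (by rintro _ _ ⟨rfl, rfl⟩; exact h)
  map_rel' := by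
    rintro _ _ ⟨-, a, b, hab, rfl, rfl⟩
    exact φ.map_adj hab

theorem card_identified_lt [Finite V] {x y : V} (hxy : x ≠ y) :
    Nat.card (Identified x y) < Nat.card V := by
  refine (Nat.card_le_card_of_surjective _ Quot.mk_surjective).lt_of_ne fun h => hxy ?_
  exact ((Nat.bijective_iff_surjective_and_card _).2 ⟨Quot.mk_surjective, h.symm⟩).1
    (Quot.sound ⟨rfl, rfl⟩)

theorem foldsTo_cycleGraph_of_not_isExact [Finite V] [Fact (2 < n)] (hn : Even n) (hG : G.Connected)
    {g : G →g zmodCycle n} (hg : ¬ IsExact G (cyclicStep on g)) : FoldsTo G (cycleGraph n) := by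
  induction hN : Nat.card V using Nat.strong_induction_on generalizing V with
  | _ N ih =>
    by_cases hinj : ∀ g : G →g zmodCycle n, ¬ IsExact G (cyclicStep on g) →
        ∀ u, (G.neighborSet u).InjOn g
    · have : NeZero n := ⟨(pos_of_gt (Fact.out : 2 < n)).ne'⟩
      obtain ⟨e⟩ := nonempty_zmodCycle_iso_of_forall_injOn hn hG hg hinj
      obtain ⟨e'⟩ := nonempty_zmodCycle_iso_cycleGraph (n := n)
      exact ⟨_, .iso (e.symm.trans e')⟩
    · simp only [Set.InjOn, not_forall] at hinj
      obtain ⟨g, hg, z, x, hx, y, hy, hgxy, hxy⟩ := hinj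
      have hdist : G.dist x y = 2 := dist_eq_two_iff.2
        ⟨hxy, fun h => (g.map_adj h).ne hgxy, z, G.adj_symm hx, G.adj_symm hy⟩
      obtain ⟨f, hf⟩ := ih _ (hN ▸ card_identified_lt hxy) (G := identify G x y)
        (hG.map (elementaryFold G x y hdist) Quot.mk_surjective) (g := identifyLift g hgxy)
        (fun h => hg (h.comp_hom (elementaryFold G x y hdist))) rfl
      exact ⟨_, .comp x y hdist f hf⟩

theorem IsWindless.of_foldsTo {H : SimpleGraph W} (hG : IsWindless p q G) (h : FoldsTo G H) :
    IsWindless p q H := by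
  obtain ⟨φ, hφ⟩ := h
  exact ⟨isBipartite_iff_isExact_one.2 (hφ.isExact (isBipartite_iff_isExact_one.1 hG.1)),
    fun f => hφ.isExact (hG.2 (f.comp φ))⟩

end Fold

section OddCycle

variable {V : Type u} {G : SimpleGraph V} {q : ℕ}

theorem displacement_eq_one_or_neg_one (hq : 0 < q) {a b : Fin (2 * q + 1)}
    (h : (circularClique (2 * q + 1) q).Adj a b) :
    displacement a b = 1 ∨ displacement a b = -1 := by
  rw [circularClique_adj_iff hq, abs_le, displacement] at h
  rw [displacement]
  omega

/-- The cycle of length `4 q + 2` is the bipartite double cover of the odd cycle `G_{2q+1,q}`, and a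
bipartition of `G` lifts `f` to it. -/
theorem exists_hom_zmodCycle (hq : 0 < q) (hG : G.IsBipartite)
    (f : G →g circularClique (2 * q + 1) q) :
    ∃ g : G →g zmodCycle (4 * q + 2),
      ∀ u v, G.Adj u v → cyclicStep (g u) (g v) = displacement (f u) (f v) := by
  have : Fact (2 < 4 * q + 2) := ⟨by omega⟩
  obtain ⟨c, hc⟩ := exists_odd_sub_of_isBipartite hG
  let g (v : V) : ZMod (4 * q + 2) := (2 * f v + (2 * q + 1) * c v : ℤ)
  have g_sub : ∀ u v, G.Adj u v → g v - g u = (displacement (f u) (f v) : ℤ) := by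
    intro u v huv
    obtain ⟨k, hk⟩ := hc u v huv
    have hkc : c v = c u + 2 * k + 1 := by linear_combination hk
    rw [← Int.cast_sub, ZMod.intCast_eq_intCast_iff_dvd_sub, displacement_eq, hkc]
    exact ⟨-((f v - f u : ℤ) / (2 * q + 1 : ℕ) + k + 1), by push_cast; ring⟩
  have hdisp := fun u v (huv : G.Adj u v) => displacement_eq_one_or_neg_one hq (f.map_adj huv)
  refine ⟨⟨g, fun {u v} huv => zmodCycle_adj_iff.2 ?_⟩, fun u v huv =>
    cyclicStep_eq (hdisp u v huv) (g_sub u v huv)⟩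
  rw [g_sub u v huv]
  exact_mod_cast (hdisp u v huv).imp (congrArg Int.cast) (congrArg Int.cast)

theorem foldsTo_cycleGraph_of_not_isWindless [Finite V] (hq : 0 < q) (hG : G.Connected)
    (hb : G.IsBipartite) (h : ¬ IsWindless (2 * q + 1) q G) :
    FoldsTo G (cycleGraph (4 * q + 2)) := by
  have : Fact (2 < 4 * q + 2) := ⟨by omega⟩
  obtain ⟨f, hf⟩ := not_forall.1 (not_and.1 h hb)
  obtain ⟨g, hg⟩ := exists_hom_zmodCycle hq hb f
  exact foldsTo_cycleGraph_of_not_isExact ⟨2 * q + 1, by ring⟩ hG fun hexact => hf (hexact.congr hg)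

/-- Multiplication by `q + 1` winds the cycle around `G_{2q+1,q}` in steps of displacement `1`. -/
theorem not_isWindless_cycleGraph (hq : 0 < q) :
    ¬ IsWindless (2 * q + 1) q (cycleGraph (4 * q + 2)) := by
  intro h
  obtain ⟨e⟩ := nonempty_zmodCycle_iso_cycleGraph (n := 4 * q + 2)
  let φ (i : ℕ) : Fin (2 * q + 1) := residue (2 * q + 1) ((q + 1) * i)
  have displacement_step : ∀ i, displacement (φ i) (φ (i + 1)) = 1 := fun i => by
    have hstep : ((q + 1) * (i + 1 : ℕ) - (q + 1) * i : ℤ) = q + 1 := by push_cast; ring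
    rw [displacement_residue, hstep, Int.emod_eq_of_lt] <;> push_cast <;> omega
  have adj_step : ∀ i < 4 * q + 2, (circularClique (2 * q + 1) q).Adj (φ i) (φ (i + 1)) :=
    fun i _ => by
      rw [circularClique_adj_iff hq, displacement_step, abs_one]
      push_cast
      omega
  have closed : φ (4 * q + 2) = φ 0 := by
    have hmul : ((q + 1) * (4 * q + 2 : ℕ) : ℤ) =
        (0 : Fin (2 * q + 1)) + (2 * q + 1 : ℕ) * (2 * (q + 1)) := by
      rw [Fin.val_zero]; push_cast; ring
    simp only [φ, hmul, residue_val_add_mul]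
    simp [residue]
  refine not_isExact_closedWalkHom adj_step closed (w := displacement) ?_
    ((h.of_foldsTo ⟨_, .iso e.symm⟩).2 _)
  simp only [displacement_step, Finset.sum_const, Finset.card_range, nsmul_one]
  omega

end OddCycle

end CircularMixing

theorem theorem2p4 (p q : ℕ) (hlo : (2 : ℚ) < (p : ℚ) / (q : ℚ)) (hhi : (p : ℚ) / (q : ℚ) < 4)
    {V : Type u} [Finite V] (G : SimpleGraph V) :
    (∀ {W : Type v} [Finite W] (H : SimpleGraph W),
      CircularMixing.FoldsTo G H →
        ¬ CircularMixing.IsMixing p q H → ¬ CircularMixing.IsMixing p q G) ∧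
    (p = 2 * q + 1 → G.Connected → G.IsBipartite →
      (CircularMixing.IsMixing p q G ↔
        ¬ CircularMixing.FoldsTo G (SimpleGraph.cycleGraph (4 * q + 2)))) := by
  have hq : 0 < q := Nat.pos_of_ne_zero (by rintro rfl; norm_num at hlo)
  have hq' : (0 : ℚ) < q := Nat.cast_pos.2 hq
  have h2 : 2 * q < p := by exact_mod_cast (lt_div_iff₀ hq').1 hlo
  have h4 : p < 4 * q := by exact_mod_cast (div_lt_iff₀ hq').1 hhi
  refine ⟨fun {W} _ H hGH hH hG => hH ?_, ?_⟩
  · rw [CircularMixing.isMixing_iff_isWindless hq h2 h4] at hG ⊢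
    exact hG.of_foldsTo hGH
  · rintro rfl hG hb
    rw [CircularMixing.isMixing_iff_isWindless hq h2 h4]
    exact ⟨fun h hfold => CircularMixing.not_isWindless_cycleGraph hq (h.of_foldsTo hfold),
      fun h => by_contra fun hw =>
        h (CircularMixing.foldsTo_cycleGraph_of_not_isWindless hq hG hb hw)⟩
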